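/- Let $N\ge1$ and $M\ge0$ be integers, let $k_1<\dots<k_M$ be integers with $0<k_j<N$, and put $\Lambda=\{0,\dots,N\}\setminus\{k_1,\dots,k_M\}$. Let $\mathcal P(\Lambda)$ be the complex space of polynomials $\sum_{k\in\Lambda}c_kz^k$, viewed as a subspace of $L^1(\mathbb T)$ with the norm $\|f\|_1=\frac1{2\pi}\int_{\mathbb T}|f(\zeta)|\,|d\zeta|$, where $\mathbb T$ is the unit circle, and let $\mathrm{ball}(\mathcal P(\Lambda))$ be its closed unit ball. A point $\xi$ of the closed unit ball of a complex normed space $X$ is called exposed if there is a functional $\phi\in X^*$ with $\|\phi\|=1$ and $\{x\in X:\|x\|\le1,\ \phi(x)=1\}=\{\xi\}$. Let $p\in\mathcal P(\Lambda)$ with $\|p\|_1=1$, say $p(z)=\sum_{k=0}^Nc_kz^k$, and let $p^*(z)=\sum_{k=0}^N\overline{c_k}z^{N-k}$. Let $a_1,\dots,a_n$ be the distinct common zeros of $p$ and $p^*$ in the open unit disk, let $m_j$ be the minimum of the multiplicities of $a_j$ as a zero of $p$ and of $p^*$, and put $m=\sum_jm_j$. Let $\zeta_1,\dots,\zeta_\nu$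 be the distinct zeros of $p$ on $\mathbb T$, with multiplicities $\lambda_1,\dots,\lambda_\nu$, and put $\mu_j=\lfloor\lambda_j/2\rfloor$, $\mu=\sum_j\mu_j$ and $\widetilde m=m+\mu$. The polynomial $$\widetilde G(z)=\prod_{j=1}^n(z-a_j)^{m_j}(1-\overline{a_j}z)^{m_j}\prod_{j=1}^\nu(z-\zeta_j)^{\mu_j}(1-\overline{\zeta_j}z)^{\mu_j}$$ divides $p$; write $p/\widetilde G=\widetilde R=\sum_k\widetilde C_kz^k$, with $\widetilde C_k=0$ for all $k\in\mathbb Z$ outside $[0,\deg\widetilde R]$, and put $\widetilde A(k)=\operatorname{Re}\widetilde C_k$, $\widetilde B(k)=\operatorname{Im}\widetilde C_k$. For $1\le j\le M$ let $$\widetilde A^{\pm}_{j,l}=\widetilde A(k_j+l-\widetilde m)\pm\widetilde A(k_j-l-\widetilde m),\qquad \widetilde B^{\pm}_{j,l}=\widetilde B(k_j+l-\widetilde m)\pm\widetilde B(k_j-l-\widetilde m),$$ and form the real $2M\times(2\widetilde m+1)$ block matrix $$\widetilde{\mathfrak M}=\begin{pmatrix}\widetilde{\mathcal A}^+&\widetilde{\mathcal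 B}^-\\ \widetilde{\mathcal B}^+&-\widetilde{\mathcal A}^-\end{pmatrix},$$ where $\widetilde{\mathcal A}^+=(\widetilde A^+_{j,l})$ and $\widetilde{\mathcal B}^+=(\widetilde B^+_{j,l})$ have columns $l=0,\dots,\widetilde m$, while $\widetilde{\mathcal A}^-=(\widetilde A^-_{j,l})$ and $\widetilde{\mathcal B}^-=(\widetilde B^-_{j,l})$ have columns $l=1,\dots,\widetilde m$. If $\operatorname{rank}\widetilde{\mathfrak M}=2\widetilde m$, then $p$ is an exposed point of $\mathrm{ball}(\mathcal P(\Lambda))$. -/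

import Mathlib

open Polynomial MeasureTheory

noncomputable section

namespace Fewnomial

instance fact_two_pi_pos : Fact (0 < 2 * Real.pi) := ⟨Real.two_pi_pos⟩

/-- The Banach space `L¹` of the unit circle with its normalized arc length measure; the circle is
parametrized by the angle modulo `2π`, the angle `t` corresponding to the point `e^{it}`. -/
abbrev L1 : Type :=
  Lp ℂ 1 (AddCircle.haarAddCircle (T := 2 * Real.pi))

/-- The restriction of a polynomial to the unit circle, as a continuous function of the angle. -/
def onCircle : ℂ[X] →ₗ[ℂ] C(AddCircle (2 * Real.pi), ℂ) where
  toFun p := ⟨fun t => p.eval (AddCircle.toCircle t : ℂ),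
    p.continuous.comp (continuous_subtype_val.comp AddCircle.continuous_toCircle)⟩
  map_add' p q := by ext t; simp
  map_smul' c p := by ext t; simp

/-- The embedding of the polynomials into `L¹` of the circle. -/
def toL1 : ℂ[X] →ₗ[ℂ] L1 :=
  (ContinuousMap.toLp 1 AddCircle.haarAddCircle ℂ).toLinearMap ∘ₗ onCircle

/-- The set `Λ = {0, …, N} \ {k₁, …, k_M}` of admissible exponents. -/
def admissible (N : ℕ) {M : ℕ} (k : Fin M → ℕ) : Finset ℕ :=
  Finset.range (N + 1) \ Finset.univ.image k

/-- The space of polynomials `∑_{n ∈ Λ} cₙ zⁿ` with complex coefficients. -/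
def lacunary (Λ : Finset ℕ) : Submodule ℂ ℂ[X] where
  carrier := {p | ∀ n ∉ Λ, p.coeff n = 0}
  add_mem' hp hq n hn := by simp [hp n hn, hq n hn]
  zero_mem' n _ := by simp
  smul_mem' c p hp n hn := by simp [hp n hn]

/-- The space `𝒫(Λ)`, viewed as a subspace of `L¹`, with the norm inherited from there. -/
def lacunaryL1 (Λ : Finset ℕ) : Submodule ℂ L1 :=
  (lacunary Λ).map toL1

/-- A point `ξ` of the closed unit ball of `X` is exposed if some functional of norm `1` takes
the value `1` at `ξ` and at no other point of the ball. -/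
def IsExposedPointOfBall {X : Type*} [NormedAddCommGroup X] [NormedSpace ℂ X] (ξ : X) : Prop :=
  ξ ∈ Metric.closedBall (0 : X) 1 ∧
    ∃ φ : X →L[ℂ] ℂ, ‖φ‖ = 1 ∧ {x ∈ Metric.closedBall (0 : X) 1 | φ x = 1} = {ξ}

/-- `p*(z) = z^N · conj (p (1 / conj z))`, that is, `∑ conj(cₙ) z^(N-n)` for `p = ∑ cₙ zⁿ` of degree
at most `N`. -/
def pstar (N : ℕ) (p : ℂ[X]) : ℂ[X] :=
  ∑ n ∈ Finset.range (N + 1), C (starRingEnd ℂ (p.coeff n)) * X ^ (N - n)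

/-- The common zeros `a_j` of `p` and `p*` in the open unit disk. -/
def diskZeros (N : ℕ) (p : ℂ[X]) : Finset ℂ :=
  {a ∈ p.roots.toFinset ∩ (pstar N p).roots.toFinset | ‖a‖ < 1}

/-- The multiplicity `m_j` of the common zero `a = a_j`. -/
def diskMult (N : ℕ) (p : ℂ[X]) (a : ℂ) : ℕ :=
  min (p.rootMultiplicity a) ((pstar N p).rootMultiplicity a)

/-- The zeros `ζ_j` of `p` on the unit circle. -/
def circleZeros (p : ℂ[X]) : Finset ℂ :=
  {ζ ∈ p.roots.toFinset | ‖ζ‖ = 1}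

/-- The number `μ_j = [λ_j / 2]`, with `λ_j` the multiplicity of the zero `ζ = ζ_j`. -/
def circleMult (p : ℂ[X]) (ζ : ℂ) : ℕ :=
  p.rootMultiplicity ζ / 2

/-- `m̃ = m + μ`, where `m = ∑ m_j` and `μ = ∑ μ_j`. -/
def mTilde (N : ℕ) (p : ℂ[X]) : ℕ :=
  ∑ a ∈ diskZeros N p, diskMult N p a + ∑ ζ ∈ circleZeros p, circleMult p ζ

/-- `G(z) = ∏ (z - a_j)^{m_j} (1 - conj(a_j) z)^{m_j}`. -/
def G (N : ℕ) (p : ℂ[X]) : ℂ[X] :=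
  ∏ a ∈ diskZeros N p,
    (X - C a) ^ diskMult N p a * (1 - C (starRingEnd ℂ a) * X) ^ diskMult N p a

/-- `G₀(z) = ∏ (z - ζ_j)^{μ_j} (1 - conj(ζ_j) z)^{μ_j}`. -/
def G₀ (p : ℂ[X]) : ℂ[X] :=
  ∏ ζ ∈ circleZeros p,
    (X - C ζ) ^ circleMult p ζ * (1 - C (starRingEnd ℂ ζ) * X) ^ circleMult p ζ

/-- `G̃ = G G₀`. -/
def GTilde (N : ℕ) (p : ℂ[X]) : ℂ[X] := G N p * G₀ p

/-- The polynomial `R̃ = p / G̃` (`G̃` divides `p`, so that the division is exact). -/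
def RTilde (N : ℕ) (p : ℂ[X]) : ℂ[X] := p / GTilde N p

/-- The coefficients `C̃_r` of `R̃` for `r ∈ ℤ`; they vanish for `r < 0`. -/
def CTilde (N : ℕ) (p : ℂ[X]) (r : ℤ) : ℂ :=
  if 0 ≤ r then (RTilde N p).coeff r.toNat else 0

def ATilde (N : ℕ) (p : ℂ[X]) (r : ℤ) : ℝ := (CTilde N p r).re

def BTilde (N : ℕ) (p : ℂ[X]) (r : ℤ) : ℝ := (CTilde N p r).im

section Blocks

variable (N : ℕ) {M : ℕ} (k : Fin M → ℕ) (p : ℂ[X])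

/-- The block with entries `Ã(k_j + l - m̃) + Ã(k_j - l - m̃)`, `0 ≤ l ≤ m̃`. -/
def APlus : Matrix (Fin M) (Fin (mTilde N p + 1)) ℝ := Matrix.of fun j l =>
  ATilde N p ((k j : ℤ) + (l : ℕ) - mTilde N p) + ATilde N p ((k j : ℤ) - (l : ℕ) - mTilde N p)

/-- The block with entries `B̃(k_j + l - m̃) + B̃(k_j - l - m̃)`, `0 ≤ l ≤ m̃`. -/
def BPlus : Matrix (Fin M) (Fin (mTilde N p + 1)) ℝ := Matrix.of fun j l =>
  BTilde N p ((k j : ℤ) + (l : ℕ) - mTilde N p) + BTilde N p ((k j : ℤ) - (l : ℕ) - mTilde N p)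

/-- The block with entries `Ã(k_j + l - m̃) - Ã(k_j - l - m̃)`, `1 ≤ l ≤ m̃`; the column with
index `i : Fin m̃` belongs to `l = i + 1`. -/
def AMinus : Matrix (Fin M) (Fin (mTilde N p)) ℝ := Matrix.of fun j i =>
  ATilde N p ((k j : ℤ) + ((i : ℕ) + 1) - mTilde N p) -
    ATilde N p ((k j : ℤ) - ((i : ℕ) + 1) - mTilde N p)

/-- The block with entries `B̃(k_j + l - m̃) - B̃(k_j - l - m̃)`, `1 ≤ l ≤ m̃`; the column with
index `i : Fin m̃` belongs to `l = i + 1`. -/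
def BMinus : Matrix (Fin M) (Fin (mTilde N p)) ℝ := Matrix.of fun j i =>
  BTilde N p ((k j : ℤ) + ((i : ℕ) + 1) - mTilde N p) -
    BTilde N p ((k j : ℤ) - ((i : ℕ) + 1) - mTilde N p)

/-- The real `2M × (2m̃ + 1)` matrix with the blocks `Ã⁺, B̃⁻` (top) and `B̃⁺, -Ã⁻` (bottom). -/
def MTilde : Matrix (Fin M ⊕ Fin M) (Fin (mTilde N p + 1) ⊕ Fin (mTilde N p)) ℝ :=
  Matrix.fromBlocks (APlus N k p) (BMinus N k p) (BPlus N k p) (-AMinus N k p)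

end Blocks

end Fewnomial

end

open Polynomial MeasureTheory

noncomputable section

namespace Fewnomial

/-! The exposing functional is `f ↦ ∫ f conj(p)/|p|`, restricted to `𝒫(Λ)`. If `q` lies in the ball
and the functional is `1` there, equality in the triangle inequality gives `q · conj p ≥ 0` on the
whole circle (`mul_conj_nonneg_of_signFunctional_eq_one`).

Such a `q` is a multiple of `R̃` (`RTilde_dvd`): reality of `q · conj p` means `q p* = q* p`, and
after cancelling `G̃` the zeros of `R̃` off the circle must pass to `q`; on the circle the zeros of
`R̃` are simple, and there positivity forces `q` to vanish. Since `G̃ = z^m̃ g` with `g ≥ 0` on the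
circle, the cofactor `S = q / R̃` has `z^{-m̃} S` real there, so `S` ranges over a real space of
dimension `2m̃ + 1` (`exists_cofactor`).

In real coordinates on that space, the vanishing of the coefficients of `S R̃` at all `k_j` is the
linear system with matrix `M̃` (`MTilde_mulVec_symVec`). The cofactor of `p` is a nonzero solution,
and rank `2m̃` makes the kernel a line; hence `q = c p` with `c` real, and the functional gives `c =
1`. -/

theorem natDegree_le_of_mem_lacunary {N M : ℕ} {k : Fin M → ℕ} {p : ℂ[X]}
    (hp : p ∈ lacunary (admissible N k)) : p.natDegree ≤ N := by
  rw [natDegree_le_iff_coeff_eq_zero]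
  intro n hn
  apply hp n
  simp only [admissible, Finset.mem_sdiff, Finset.mem_range, not_and]
  intro h
  omega

theorem coeff_eq_zero_of_mem_lacunary {N M : ℕ} {k : Fin M → ℕ} {p : ℂ[X]}
    (hp : p ∈ lacunary (admissible N k)) (j : Fin M) : p.coeff (k j) = 0 := by
  apply hp (k j)
  simp [admissible]

/-! ### The conjugate-reciprocal polynomial -/

theorem coeff_pstar (N : ℕ) (p : ℂ[X]) (i : ℕ) :
    (pstar N p).coeff i = if i ≤ N then starRingEnd ℂ (p.coeff (N - i)) else 0 := by
  simp only [pstar, finsetSum_coeff, coeff_C_mul, coeff_X_pow]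
  split_ifs with h
  · rw [Finset.sum_eq_single (N - i)]
    · simp [Nat.sub_sub_self h]
    · intro b hb hne
      rw [Finset.mem_range] at hb
      rw [if_neg (by omega), mul_zero]
    · intro h'
      exact absurd (Finset.mem_range.2 (by omega)) h'
  · apply Finset.sum_eq_zero
    intro b hb
    rw [if_neg (by omega), mul_zero]

theorem natDegree_pstar_le (N : ℕ) (p : ℂ[X]) : (pstar N p).natDegree ≤ N := by
  rw [natDegree_le_iff_coeff_eq_zero]
  intro n hn
  rw [coeff_pstar, if_neg (by omega)]

theorem pstar_pstar {N : ℕ} {p : ℂ[X]} (hp : p.natDegree ≤ N) : pstar N (pstar N p) = p := by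
  ext i
  rw [coeff_pstar]
  split_ifs with h
  · rw [coeff_pstar, if_pos (by omega), Nat.sub_sub_self h, Complex.conj_conj]
  · exact (coeff_eq_zero_of_natDegree_lt (by omega)).symm

theorem pstar_ne_zero {N : ℕ} {p : ℂ[X]} (hp : p.natDegree ≤ N) (h0 : p ≠ 0) : pstar N p ≠ 0 := by
  intro h
  apply h0
  rw [← pstar_pstar hp, h]
  simp [pstar]

theorem pstar_eq_reflect {N : ℕ} {p : ℂ[X]} (hp : p.natDegree ≤ N) :
    pstar N p = reflect N (p.map (starRingEnd ℂ)) := by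
  ext i
  rw [coeff_pstar, coeff_reflect, coeff_map]
  split_ifs with h
  · rw [revAt_le h]
  · rw [revAt_eq_self_of_lt (by omega), coeff_eq_zero_of_natDegree_lt (by omega), map_zero]

theorem pstar_mul {m n : ℕ} {f g : ℂ[X]} (hf : f.natDegree ≤ m) (hg : g.natDegree ≤ n) :
    pstar (m + n) (f * g) = pstar m f * pstar n g := by
  rw [pstar_eq_reflect hf, pstar_eq_reflect hg,
    pstar_eq_reflect (natDegree_mul_le.trans (add_le_add hf hg)), Polynomial.map_mul,
    reflect_mul _ _ (natDegree_map_le.trans hf) (natDegree_map_le.trans hg)]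

theorem pstar_X_sub_C (a : ℂ) : pstar 1 (X - C a) = 1 - C (starRingEnd ℂ a) * X := by
  ext i
  rw [coeff_pstar]
  rcases i with _ | _ | i
  · simp
  · simp [coeff_one]
  · simp [coeff_one]

theorem pstar_X_sub_C_pow (a : ℂ) (m : ℕ) :
    pstar m ((X - C a) ^ m) = (1 - C (starRingEnd ℂ a) * X) ^ m := by
  induction m with
  | zero => simp [pstar]
  | succ m ih =>
    rw [pow_succ, pstar_mul (by simp) (by simp), ih, pstar_X_sub_C, pow_succ]

/-- A zero of `p` at `a` gives a zero of `p*` at the point symmetric to `a`. -/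
theorem pow_dvd_pstar {N : ℕ} {p : ℂ[X]} (hp : p.natDegree ≤ N) (h0 : p ≠ 0) {a : ℂ} {m : ℕ}
    (h : (X - C a) ^ m ∣ p) : (1 - C (starRingEnd ℂ a) * X) ^ m ∣ pstar N p := by
  obtain ⟨g, rfl⟩ := h
  have hg : g ≠ 0 := right_ne_zero_of_mul h0
  have hdeg : ((X - C a) ^ m * g).natDegree = m + g.natDegree := by
    rw [natDegree_mul (pow_ne_zero _ (X_sub_C_ne_zero a)) hg]; simp
  have hN : N = m + (N - m) := by omega
  rw [hN, pstar_mul (by simp) (by omega), pstar_X_sub_C_pow]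
  exact dvd_mul_right _ _

theorem one_sub_conj_mul_X {a : ℂ} (ha : a ≠ 0) :
    1 - C (starRingEnd ℂ a) * X = C (-starRingEnd ℂ a) * (X - C (starRingEnd ℂ a)⁻¹) := by
  have h : starRingEnd ℂ a ≠ 0 := by simpa using ha
  rw [mul_sub, ← C_mul]
  simp [h]
  ring

theorem associated_one_sub_conj {a : ℂ} (ha : a ≠ 0) :
    Associated (1 - C (starRingEnd ℂ a) * X) (X - C (starRingEnd ℂ a)⁻¹) := by
  rw [one_sub_conj_mul_X ha]
  exact associated_unit_mul_left _ _ (isUnit_C.2 (by simpa using ha))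

/-- The converse direction of the reflection `a ↔ 1 / conj a`. The point `a = 0` is excluded because
its mirror image is infinity and the factor degenerates to `1`. -/
theorem pow_dvd_pstar_symm {N : ℕ} {p : ℂ[X]} (hp : p.natDegree ≤ N) (h0 : p ≠ 0) {a : ℂ}
    (ha : a ≠ 0) {m : ℕ} (h : (1 - C (starRingEnd ℂ a) * X) ^ m ∣ p) :
    (X - C a) ^ m ∣ pstar N p := by
  have h1 := ((associated_one_sub_conj ha).pow_pow (n := m)).dvd_iff_dvd_left.1 h
  have h2 := pow_dvd_pstar hp h0 h1
  have hb : (starRingEnd ℂ a)⁻¹ ≠ 0 := by simpa using ha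
  have h3 := ((associated_one_sub_conj hb).pow_pow (n := m)).dvd_iff_dvd_left.1 h2
  simpa using h3

theorem eval_pstar {N : ℕ} {p : ℂ[X]} (hp : p.natDegree ≤ N) {z : ℂ} (hz : ‖z‖ = 1) :
    (pstar N p).eval z = z ^ N * starRingEnd ℂ (p.eval z) := by
  have hzz : z * starRingEnd ℂ z = 1 := by
    rw [Complex.mul_conj, Complex.normSq_eq_norm_sq, hz]; simp
  rw [eval_eq_sum_range' (Nat.lt_succ_of_le hp), map_sum, pstar, eval_finsetSum, Finset.mul_sum]
  apply Finset.sum_congr rfl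
  intro n hn
  have hn : n ≤ N := by simpa [Nat.lt_succ_iff] using hn
  simp only [eval_mul, eval_C, eval_pow, eval_X, map_mul, map_pow]
  have : z ^ N = z ^ (N - n) * z ^ n := by rw [← pow_add]; congr 1; omega
  rw [this]
  have hn1 : z ^ n * starRingEnd ℂ z ^ n = 1 := by rw [← mul_pow, hzz, one_pow]
  linear_combination (-(starRingEnd ℂ (p.coeff n) * z ^ (N - n))) * hn1

/-! ### The polynomial `G̃` -/

theorem mem_diskZeros {N : ℕ} {p : ℂ[X]} (hp : p ≠ 0) (hps : pstar N p ≠ 0) {a : ℂ} :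
    a ∈ diskZeros N p ↔ (X - C a ∣ p ∧ X - C a ∣ pstar N p) ∧ ‖a‖ < 1 := by
  simp [diskZeros, hp, hps, dvd_iff_isRoot]

theorem mem_circleZeros {p : ℂ[X]} (hp : p ≠ 0) {ζ : ℂ} :
    ζ ∈ circleZeros p ↔ X - C ζ ∣ p ∧ ‖ζ‖ = 1 := by
  simp [circleZeros, hp, dvd_iff_isRoot]

theorem isCoprime_of_combination {f g u v : ℂ[X]} {c : ℂ} (hc : c ≠ 0) (h : u * f + v * g = C c) :
    IsCoprime f g := by
  refine ⟨C c⁻¹ * u, C c⁻¹ * v, ?_⟩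
  rw [mul_assoc, mul_assoc, ← mul_add, h, ← C_mul, inv_mul_cancel₀ hc, C_1]

theorem isCoprime_X_sub_C_one_sub {a b : ℂ} (h : 1 - starRingEnd ℂ b * a ≠ 0) :
    IsCoprime (X - C a) (1 - C (starRingEnd ℂ b) * X) := by
  apply isCoprime_of_combination (u := C (starRingEnd ℂ b)) (v := 1) h
  simp; ring

theorem isCoprime_one_sub_one_sub {a b : ℂ} (h : a ≠ b) :
    IsCoprime (1 - C (starRingEnd ℂ a) * X) (1 - C (starRingEnd ℂ b) * X) := by
  apply isCoprime_of_combination (u := C (starRingEnd ℂ b)) (v := - C (starRingEnd ℂ a))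
    (c := starRingEnd ℂ b - starRingEnd ℂ a)
  · exact sub_ne_zero.2 fun h' => h ((starRingEnd ℂ).injective h').symm
  · simp; ring

theorem one_sub_conj_mul_ne_zero {a b : ℂ} (h : ‖a‖ * ‖b‖ < 1) :
    1 - starRingEnd ℂ b * a ≠ 0 := by
  intro h0
  have : ‖starRingEnd ℂ b * a‖ = 1 := by rw [← sub_eq_zero.1 h0]; simp
  rw [norm_mul, Complex.norm_conj] at this
  nlinarith

theorem one_sub_conj_mul_ne_zero_of_norm_eq_one {a b : ℂ} (hb : ‖b‖ = 1) (h : a ≠ b) :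
    1 - starRingEnd ℂ b * a ≠ 0 := by
  have hbb : b * starRingEnd ℂ b = 1 := by
    rw [Complex.mul_conj, Complex.normSq_eq_norm_sq, hb]; simp
  intro h0
  apply h
  linear_combination (-b) * h0 - a * hbb

theorem one_sub_conj_mul_ne_zero_of_ne {a b : ℂ} (ha : ‖a‖ ≤ 1) (hb : ‖b‖ ≤ 1) (h : a ≠ b) :
    1 - starRingEnd ℂ b * a ≠ 0 := by
  rcases hb.lt_or_eq with hb' | hb'
  · exact one_sub_conj_mul_ne_zero (by nlinarith [norm_nonneg a, norm_nonneg b])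
  · exact one_sub_conj_mul_ne_zero_of_norm_eq_one hb' h

/-- The factor `(z - a)^m (1 - conj(a) z)^m`. -/
def symFactor (a : ℂ) (m : ℕ) : ℂ[X] := (X - C a) ^ m * (1 - C (starRingEnd ℂ a) * X) ^ m

/-- The zeros lie in the mirror pairs `{a, 1 / conj a}` and `{b, 1 / conj b}`, which are disjoint
for distinct points of the closed disk. This reduces divisibility by `G̃` to one factor at a time.
-/
theorem isCoprime_symFactor {a b : ℂ} (ha : ‖a‖ ≤ 1) (hb : ‖b‖ ≤ 1) (h : a ≠ b) (m n : ℕ) :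
    IsCoprime (symFactor a m) (symFactor b n) := by
  have h1 : IsCoprime (X - C a) (X - C b) := isCoprime_X_sub_C_of_isUnit_sub (by
    simpa [sub_eq_zero] using h)
  have h2 := isCoprime_X_sub_C_one_sub (one_sub_conj_mul_ne_zero_of_ne ha hb h)
  have h3 := (isCoprime_X_sub_C_one_sub (one_sub_conj_mul_ne_zero_of_ne hb ha h.symm)).symm
  have h4 := isCoprime_one_sub_one_sub h
  exact IsCoprime.mul_left (IsCoprime.mul_right h1.pow h2.pow) (IsCoprime.mul_right h3.pow h4.pow)

theorem GTilde_eq_prod (N : ℕ) (p : ℂ[X]) : GTilde N p =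
    (∏ a ∈ diskZeros N p, symFactor a (diskMult N p a)) *
      ∏ ζ ∈ circleZeros p, symFactor ζ (circleMult p ζ) := rfl

theorem norm_lt_one_of_mem_diskZeros {N : ℕ} {p : ℂ[X]} {a : ℂ} (ha : a ∈ diskZeros N p) :
    ‖a‖ < 1 := (Finset.mem_filter.1 ha).2

theorem norm_eq_one_of_mem_circleZeros {p : ℂ[X]} {a : ℂ} (ha : a ∈ circleZeros p) :
    ‖a‖ = 1 := (Finset.mem_filter.1 ha).2

theorem GTilde_dvd {N : ℕ} {p f : ℂ[X]}
    (h1 : ∀ a ∈ diskZeros N p, symFactor a (diskMult N p a) ∣ f)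
    (h2 : ∀ a ∈ circleZeros p, symFactor a (circleMult p a) ∣ f) : GTilde N p ∣ f := by
  rw [GTilde_eq_prod]
  refine IsCoprime.mul_dvd ?_ (Finset.prod_dvd_of_coprime ?_ h1) (Finset.prod_dvd_of_coprime ?_ h2)
  · refine IsCoprime.prod_left fun a ha => IsCoprime.prod_right fun b hb => ?_
    have ha' := norm_lt_one_of_mem_diskZeros ha
    have hb' := norm_eq_one_of_mem_circleZeros hb
    exact isCoprime_symFactor ha'.le hb'.le (by rintro rfl; linarith) _ _
  · intro a ha b hb hab
    exact isCoprime_symFactor (norm_lt_one_of_mem_diskZeros ha).le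
      (norm_lt_one_of_mem_diskZeros hb).le hab _ _
  · intro a ha b hb hab
    exact isCoprime_symFactor (norm_eq_one_of_mem_circleZeros ha).le
      (norm_eq_one_of_mem_circleZeros hb).le hab _ _

theorem symFactor_dvd {a : ℂ} (ha : ‖a‖ < 1) {m : ℕ} {f : ℂ[X]} (h1 : (X - C a) ^ m ∣ f)
    (h2 : (1 - C (starRingEnd ℂ a) * X) ^ m ∣ f) : symFactor a m ∣ f := by
  refine IsCoprime.mul_dvd (IsCoprime.pow (isCoprime_X_sub_C_one_sub ?_)) h1 h2
  exact one_sub_conj_mul_ne_zero (by nlinarith [norm_nonneg a])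

theorem conj_inv_of_norm_eq_one {a : ℂ} (ha : ‖a‖ = 1) : (starRingEnd ℂ a)⁻¹ = a := by
  have hbb : a * starRingEnd ℂ a = 1 := by
    rw [Complex.mul_conj, Complex.normSq_eq_norm_sq, ha]; simp
  exact inv_eq_of_mul_eq_one_left hbb

theorem ne_zero_of_norm_eq_one {a : ℂ} (ha : ‖a‖ = 1) : a ≠ 0 := by
  rintro rfl; simp at ha

/-- A point of the circle is its own mirror image, so the two linear factors coincide up to a unit.
-/
theorem associated_symFactor {a : ℂ} (ha : ‖a‖ = 1) (m : ℕ) :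
    Associated (symFactor a m) ((X - C a) ^ (2 * m)) := by
  have h := associated_one_sub_conj (ne_zero_of_norm_eq_one ha)
  rw [conj_inv_of_norm_eq_one ha] at h
  rw [two_mul, pow_add]
  exact Associated.mul_left _ h.pow_pow

theorem pow_diskMult_dvd (N : ℕ) (p : ℂ[X]) (a : ℂ) : (X - C a) ^ diskMult N p a ∣ p :=
  (pow_dvd_pow _ (min_le_left _ _)).trans (pow_rootMultiplicity_dvd p a)

theorem pow_diskMult_dvd_pstar (N : ℕ) (p : ℂ[X]) (a : ℂ) :
    (X - C a) ^ diskMult N p a ∣ pstar N p :=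
  (pow_dvd_pow _ (min_le_right _ _)).trans (pow_rootMultiplicity_dvd _ a)

theorem pow_circleMult_dvd (p : ℂ[X]) (a : ℂ) : (X - C a) ^ (2 * circleMult p a) ∣ p :=
  (pow_dvd_pow _ (Nat.mul_div_le _ _)).trans (pow_rootMultiplicity_dvd p a)

/-- In the disk, the zero of `p` supplies the factor at `a`, and the zero of `p*` reflects to the
factor of `p` at `1 / conj a`. -/
theorem GTilde_dvd_self {N : ℕ} {p : ℂ[X]} (hp : p.natDegree ≤ N) (h0 : p ≠ 0) :
    GTilde N p ∣ p := by
  refine GTilde_dvd (fun a ha => ?_) fun a ha => ?_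
  · refine symFactor_dvd (norm_lt_one_of_mem_diskZeros ha) (pow_diskMult_dvd N p a) ?_
    have := pow_dvd_pstar (natDegree_pstar_le N p) (pstar_ne_zero hp h0)
      (pow_diskMult_dvd_pstar N p a)
    rwa [pstar_pstar hp] at this
  · rw [(associated_symFactor (norm_eq_one_of_mem_circleZeros ha) _).dvd_iff_dvd_left]
    exact pow_circleMult_dvd p a

theorem GTilde_dvd_pstar {N : ℕ} {p : ℂ[X]} (hp : p.natDegree ≤ N) (h0 : p ≠ 0) :
    GTilde N p ∣ pstar N p := by
  refine GTilde_dvd (fun a ha => ?_) fun a ha => ?_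
  · exact symFactor_dvd (norm_lt_one_of_mem_diskZeros ha) (pow_diskMult_dvd_pstar N p a)
      (pow_dvd_pstar hp h0 (pow_diskMult_dvd N p a))
  · have ha' := norm_eq_one_of_mem_circleZeros ha
    rw [(associated_symFactor ha' _).dvd_iff_dvd_left]
    have h := associated_one_sub_conj (ne_zero_of_norm_eq_one ha')
    rw [conj_inv_of_norm_eq_one ha'] at h
    exact h.pow_pow.dvd_iff_dvd_left.1 (pow_dvd_pstar hp h0 (pow_circleMult_dvd p a))

theorem GTilde_ne_zero {N : ℕ} {p : ℂ[X]} (hp : p.natDegree ≤ N) (h0 : p ≠ 0) :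
    GTilde N p ≠ 0 := ne_zero_of_dvd_ne_zero h0 (GTilde_dvd_self hp h0)

theorem GTilde_mul_RTilde {N : ℕ} {p : ℂ[X]} (hp : p.natDegree ≤ N) (h0 : p ≠ 0) :
    GTilde N p * RTilde N p = p :=
  EuclideanDomain.mul_div_cancel' (GTilde_ne_zero hp h0) (GTilde_dvd_self hp h0)

/-- Off the unit circle the cofactors of `G̃` in `p` and in `p*` have no common zero. -/
theorem not_common_root_of_norm_ne_one {N : ℕ} {p R' : ℂ[X]} (hp : p.natDegree ≤ N) (h0 : p ≠ 0)
    (hR' : pstar N p = GTilde N p * R') {b : ℂ} (hb : ‖b‖ ≠ 1) (h1 : X - C b ∣ RTilde N p) :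
    ¬ X - C b ∣ R' := by
  intro h2
  have hps := pstar_ne_zero hp h0
  have hp1 := natDegree_pstar_le N p
  have hpR := GTilde_mul_RTilde hp h0
  -- One more common factor `X - a` would exceed the minimum of the two multiplicities.
  have key : ∀ a : ℂ,
      ((X - C a) ^ (diskMult N p a + 1) ∣ p) → ((X - C a) ^ (diskMult N p a + 1) ∣ pstar N p) →
      False := by
    intro a h3 h4
    have h5 := (le_rootMultiplicity_iff h0).2 h3
    have h6 := (le_rootMultiplicity_iff hps).2 h4
    have : diskMult N p a + 1 ≤ diskMult N p a := le_min h5 h6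
    omega
  have hdp : X - C b ∣ p := hpR ▸ h1.mul_left _
  have hdps : X - C b ∣ pstar N p := hR' ▸ h2.mul_left _
  have hsym : ∀ a ∈ diskZeros N p, symFactor a (diskMult N p a) ∣ GTilde N p := fun a ha =>
    (Finset.dvd_prod_of_mem (fun a => symFactor a (diskMult N p a)) ha).mul_right _
  rcases hb.lt_or_gt with hb | hb
  · have hmem := (mem_diskZeros h0 hps).2 ⟨⟨hdp, hdps⟩, hb⟩
    have hG := (dvd_mul_right _ _ : _ ∣ symFactor b (diskMult N p b)).trans (hsym b hmem)
    refine key b ?_ ?_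
    · have := mul_dvd_mul hG h1
      rwa [hpR, ← pow_succ] at this
    · have := mul_dvd_mul hG h2
      rwa [← hR', ← pow_succ] at this
  · have hb0 : b ≠ 0 := by rintro rfl; simp at hb; linarith
    -- Outside the disk, pass to the mirror image `a`; reflection exchanges the roles of `p` and
    -- `p*`.
    obtain ⟨a, rfl⟩ : ∃ a : ℂ, b = (starRingEnd ℂ a)⁻¹ := ⟨(starRingEnd ℂ b)⁻¹, by simp⟩
    have ha0 : a ≠ 0 := by rintro rfl; simp at hb0
    have ha : ‖a‖ < 1 := by
      rw [norm_inv, Complex.norm_conj] at hb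
      exact (one_lt_inv₀ (norm_pos_iff.2 ha0)).1 hb
    have has := associated_one_sub_conj ha0
    rw [← has.dvd_iff_dvd_left] at h1 h2 hdp hdps
    have hq1 : X - C a ∣ pstar N p := by
      simpa using pow_dvd_pstar_symm hp h0 ha0 (m := 1) (by simpa using hdp)
    have hq2 : X - C a ∣ p := by
      have := pow_dvd_pstar_symm hp1 hps ha0 (m := 1) (by simpa using hdps)
      rwa [pow_one, pstar_pstar hp] at this
    have hmem := (mem_diskZeros h0 hps).2 ⟨⟨hq2, hq1⟩, ha⟩
    have hG := (dvd_mul_left _ _ : _ ∣ symFactor a (diskMult N p a)).trans (hsym a hmem)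
    refine key a ?_ ?_
    · have := mul_dvd_mul hG h2
      rw [← hR', ← pow_succ] at this
      simpa only [pstar_pstar hp] using pow_dvd_pstar_symm hp1 hps ha0 this
    · have := mul_dvd_mul hG h1
      rw [hpR, ← pow_succ] at this
      exact pow_dvd_pstar_symm hp h0 ha0 this

/-- The zeros of `R̃` on the unit circle are simple. -/
theorem not_sq_dvd_RTilde {N : ℕ} {p : ℂ[X]} (hp : p.natDegree ≤ N) (h0 : p ≠ 0) {b : ℂ}
    (hb : ‖b‖ = 1) : ¬ (X - C b) ^ 2 ∣ RTilde N p := by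
  intro h
  have hpR := GTilde_mul_RTilde hp h0
  have hdp : X - C b ∣ p := hpR ▸ ((dvd_pow_self _ two_ne_zero).trans h).mul_left _
  have hmem := (mem_circleZeros h0).2 ⟨hdp, hb⟩
  have hG : (X - C b) ^ (2 * circleMult p b) ∣ GTilde N p :=
    (associated_symFactor hb _).dvd_iff_dvd_left.1
      ((Finset.dvd_prod_of_mem (fun a => symFactor a (circleMult p a)) hmem).mul_left _)
  have h1 : (X - C b) ^ (2 * circleMult p b + 2) ∣ p := by
    have := mul_dvd_mul hG h
    rwa [hpR, ← pow_add] at this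
  have h2 := (le_rootMultiplicity_iff h0).2 h1
  -- Contradiction, since `2⌊λ/2⌋ + 2 > λ`.
  unfold circleMult at h2
  omega

/-- On the unit circle `G̃(z) = z^m̃ g(z)` with `g ≥ 0`. -/
theorem exists_eval_GTilde (N : ℕ) (p : ℂ[X]) {z : ℂ} (hz : ‖z‖ = 1) :
    ∃ g : ℝ, 0 ≤ g ∧ (GTilde N p).eval z = z ^ mTilde N p * g := by
  have hzz : z * starRingEnd ℂ z = 1 := by
    rw [Complex.mul_conj, Complex.normSq_eq_norm_sq, hz]; simp
  -- For `|z| = 1`, `(z - a)(1 - conj(a) z) = z |z - a|²`.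
  have h1 : ∀ (a : ℂ) (m : ℕ),
      (symFactor a m).eval z = z ^ m * ((Complex.normSq (z - a) ^ m : ℝ) : ℂ) := by
    intro a m
    rw [symFactor, Complex.ofReal_pow, ← Complex.mul_conj, ← mul_pow, ← mul_pow]
    simp only [eval_pow, eval_mul, eval_sub, eval_X, eval_C, eval_one, map_sub]
    congr 1
    linear_combination (-(z - a)) * hzz
  refine ⟨(∏ a ∈ diskZeros N p, Complex.normSq (z - a) ^ diskMult N p a) *
    ∏ a ∈ circleZeros p, Complex.normSq (z - a) ^ circleMult p a, ?_, ?_⟩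
  · exact mul_nonneg (Finset.prod_nonneg fun a _ => pow_nonneg (Complex.normSq_nonneg _) _)
      (Finset.prod_nonneg fun a _ => pow_nonneg (Complex.normSq_nonneg _) _)
  · rw [GTilde_eq_prod, eval_mul, eval_prod, eval_prod]
    simp only [h1, Finset.prod_mul_distrib, Finset.prod_pow_eq_pow_sum]
    rw [mTilde, pow_add]
    push_cast
    ring

/-! ### Functions on the unit circle -/

theorem exists_exp_of_norm_eq_one {z : ℂ} (hz : ‖z‖ = 1) : ∃ t : ℝ, Complex.exp (t * Complex.I) = z :=
  ⟨z.arg, by simpa [hz] using Complex.norm_mul_exp_arg_mul_I z⟩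

theorem countable_exp_preimage {s : Set ℂ} (hs : s.Finite) :
    {t : ℝ | Complex.exp (t * Complex.I) ∈ s}.Countable := by
  have : {t : ℝ | Complex.exp (t * Complex.I) ∈ s} =
      ⋃ w ∈ s, {t : ℝ | Complex.exp (t * Complex.I) = w} := by
    ext t; simp
  rw [this]
  refine hs.countable.biUnion fun w _ => ?_
  by_cases h : ∃ t₀ : ℝ, Complex.exp (t₀ * Complex.I) = w
  · obtain ⟨t₀, rfl⟩ := h
    refine (Set.countable_range fun n : ℤ => t₀ + n * (2 * Real.pi)).mono ?_
    intro t ht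
    have h1 : Circle.exp t = Circle.exp t₀ := Subtype.ext (by simpa [Circle.coe_exp] using ht)
    obtain ⟨n, hn⟩ := Circle.exp_eq_exp.1 h1
    exact ⟨n, hn.symm⟩
  · convert Set.countable_empty
    ext t
    simp only [Set.mem_ofPred_eq, Set.mem_empty_iff_false, iff_false]
    exact fun ht => h ⟨t, ht⟩

theorem infinite_unit_circle : {z : ℂ | ‖z‖ = 1}.Infinite := by
  intro h
  have h1 := countable_exp_preimage h
  have h2 : {t : ℝ | Complex.exp (t * Complex.I) ∈ {z : ℂ | ‖z‖ = 1}} = Set.univ := by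
    ext t; simp [Complex.norm_exp_ofReal_mul_I]
  rw [h2] at h1
  exact Set.not_countable_univ h1

theorem eq_of_eval_eq_on_circle {f g : ℂ[X]} (h : ∀ z : ℂ, ‖z‖ = 1 → f.eval z = g.eval z) :
    f = g :=
  eq_of_infinite_eval_eq f g (infinite_unit_circle.mono h)

/-- If `g ≥ 0` on the circle up to the factor `z^m`, and `q · conj (g R) ≥ 0` there, then also
`q · conj (z^m R) ≥ 0`. -/
theorem nonneg_of_mul_nonneg_on_circle {g R q : ℂ[X]} {m : ℕ} (hg : g ≠ 0)
    (hgm : ∀ z : ℂ, ‖z‖ = 1 → ∃ r : ℝ, 0 ≤ r ∧ g.eval z = z ^ m * r)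
    (h : ∀ z : ℂ, ‖z‖ = 1 → ∃ r : ℝ, 0 ≤ r ∧
      q.eval z * starRingEnd ℂ ((g * R).eval z) = r) {z : ℂ} (hz : ‖z‖ = 1) :
    ∃ r : ℝ, 0 ≤ r ∧ q.eval z * starRingEnd ℂ ((X ^ m * R).eval z) = r := by
  set F : ℝ → ℂ := fun t => q.eval (Complex.exp (t * Complex.I)) *
    starRingEnd ℂ ((X ^ m * R).eval (Complex.exp (t * Complex.I))) with hF
  have hcE : Continuous fun t : ℝ => Complex.exp (t * Complex.I) := by fun_prop
  have hcF : Continuous F :=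
    (q.continuous.comp hcE).mul (Complex.continuous_conj.comp ((X ^ m * R).continuous.comp hcE))
  set s : Set ℝ := {t : ℝ | Complex.exp (t * Complex.I) ∈ {w | g.eval w = 0}} with hs
  have hfin : {w | g.eval w = 0}.Finite := by
    simpa [IsRoot] using Polynomial.finite_setOfPred_isRoot hg
  -- Dividing by `g` is legitimate off countably many angles; the closed condition `F t ∈ K` then
  -- extends by density and continuity.
  have hd : Dense sᶜ := (countable_exp_preimage hfin).dense_compl ℝ
  set K : Set ℂ := {w | 0 ≤ w.re ∧ w.im = 0} with hK
  have hKc : IsClosed K := (isClosed_le continuous_const Complex.continuous_re).inter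
    (isClosed_eq Complex.continuous_im continuous_const)
  have hsub : sᶜ ⊆ F ⁻¹' K := by
    intro t ht
    have hE : ‖Complex.exp (t * Complex.I)‖ = 1 := Complex.norm_exp_ofReal_mul_I t
    obtain ⟨r, hr, hr'⟩ := hgm _ hE
    obtain ⟨r₁, hr₁, hr₁'⟩ := h _ hE
    have hr0 : r ≠ 0 := by
      rintro rfl
      refine ht (show g.eval _ = 0 from ?_)
      simpa using hr'
    have hFt : F t = ((r₁ / r : ℝ) : ℂ) := by
      rw [Complex.ofReal_div, eq_div_iff (Complex.ofReal_ne_zero.2 hr0), ← hr₁', hF]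
      simp only [eval_mul, eval_pow, eval_X, hr', map_mul, Complex.conj_ofReal]
      ring
    show F t ∈ K
    rw [hFt]
    exact ⟨by simpa only [Complex.ofReal_re] using div_nonneg hr₁ hr, Complex.ofReal_im _⟩
  obtain ⟨t, rfl⟩ := exists_exp_of_norm_eq_one hz
  have : t ∈ F ⁻¹' K :=
    closure_minimal hsub (hKc.preimage hcF) (hd t)
  exact ⟨(F t).re, this.1, (Complex.ext (Complex.ofReal_re _).symm
    (this.2.trans (Complex.ofReal_im _).symm) : F t = ((F t).re : ℂ))⟩

/-- If `q · conj W ≥ 0` on the circle and `W` has a simple zero at a point of the circle, then `q`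
vanishes there. -/
theorem eval_eq_zero_of_simple_root {q W : ℂ[X]}
    (h : ∀ z : ℂ, ‖z‖ = 1 → ∃ r : ℝ, 0 ≤ r ∧ q.eval z * starRingEnd ℂ (W.eval z) = r)
    {z : ℂ} (hz : ‖z‖ = 1) (hW : W.eval z = 0) (hW' : W.derivative.eval z ≠ 0) :
    q.eval z = 0 := by
  obtain ⟨t₀, rfl⟩ := exists_exp_of_norm_eq_one hz
  set E : ℝ → ℂ := fun t => Complex.exp (t * Complex.I) with hE
  have hEd : HasDerivAt E (E t₀ * Complex.I) t₀ := by
    have h1 : HasDerivAt (fun t : ℝ => (t : ℂ) * Complex.I) (1 * Complex.I) t₀ :=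
      (Complex.ofRealCLM.hasDerivAt (x := t₀)).mul_const _
    simpa [hE] using h1.cexp
  have hq := (q.hasDerivAt (E t₀)).comp t₀ hEd
  have hWd := ((W.hasDerivAt (E t₀)).comp t₀ hEd).star
  have hF := hq.mul hWd
  set F : ℝ → ℂ := fun t => q.eval (E t) * starRingEnd ℂ (W.eval (E t)) with hFdef
  -- As `W` vanishes at the point, only this term of the product rule survives. It must be `0`,
  -- since `F ≥ 0` attains its minimum `0` at `t₀`; the other factor is nonzero, so `q` vanishes.
  set F' : ℂ := q.eval (E t₀) * star (W.derivative.eval (E t₀) * (E t₀ * Complex.I)) with hF'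
  have hFd : HasDerivAt F F' t₀ := by
    have hW0 : ((fun x => W.eval x) ∘ E) t₀ = 0 := hW
    rw [hW0, star_zero, mul_zero, zero_add] at hF
    exact hF
  have hFt₀ : F t₀ = 0 := by simp [hFdef, hE, hW]
  have hnn : ∀ t, 0 ≤ (F t).re ∧ (F t).im = 0 := by
    intro t
    obtain ⟨r, hr, hr'⟩ := h (E t) (Complex.norm_exp_ofReal_mul_I t)
    rw [show F t = r from hr']
    simpa using hr
  have hre : F'.re = 0 := by
    have h1 : HasDerivAt (fun t => (F t).re) F'.re t₀ :=
      Complex.reCLM.hasFDerivAt.comp_hasDerivAt t₀ hFd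
    refine IsLocalMin.hasDerivAt_eq_zero (Filter.Eventually.of_forall fun t => ?_) h1
    simpa [hFt₀] using (hnn t).1
  have him : F'.im = 0 := by
    have h1 : HasDerivAt (fun t => (F t).im) F'.im t₀ :=
      Complex.imCLM.hasFDerivAt.comp_hasDerivAt t₀ hFd
    refine IsLocalMin.hasDerivAt_eq_zero (Filter.Eventually.of_forall fun t => ?_) h1
    simp [hFt₀, (hnn t).2]
  have h0 : F' = 0 := Complex.ext hre him
  rcases mul_eq_zero.1 h0 with h0 | h0
  · exact h0
  · rw [star_eq_zero] at h0
    exact absurd h0 (mul_ne_zero hW' (mul_ne_zero (Complex.exp_ne_zero _) Complex.I_ne_zero))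

/-! ### Polynomials with the same argument on the circle -/

/-- Multiplicities are compared root by root. Off the circle, the identity `q R' = q* R̃` and the
absence of common zeros of `R̃` and `R'` suffice; on the circle only the sign condition helps, and
it yields exactly the simple zero that is needed. -/
theorem RTilde_dvd {N : ℕ} {p q : ℂ[X]} (hp : p.natDegree ≤ N) (h0 : p ≠ 0) (hq : q.natDegree ≤ N)
    (h : ∀ z : ℂ, ‖z‖ = 1 → ∃ r : ℝ, 0 ≤ r ∧ q.eval z * starRingEnd ℂ (p.eval z) = r) :
    RTilde N p ∣ q := by
  by_cases hq0 : q = 0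
  · rw [hq0]; exact dvd_zero _
  have hpR := GTilde_mul_RTilde hp h0
  have hG := GTilde_ne_zero hp h0
  have hR : RTilde N p ≠ 0 := right_ne_zero_of_mul (hpR ▸ h0)
  obtain ⟨R', hR'⟩ := GTilde_dvd_pstar hp h0
  have hstar : q * pstar N p = pstar N q * p := by
    refine eq_of_eval_eq_on_circle fun z hz => ?_
    obtain ⟨r, -, hr⟩ := h z hz
    have hr2 := congrArg (starRingEnd ℂ) hr
    rw [map_mul, Complex.conj_conj, Complex.conj_ofReal] at hr2
    rw [eval_mul, eval_mul, eval_pstar hp hz, eval_pstar hq hz]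
    linear_combination z ^ N * hr - z ^ N * hr2
  have hmul : q * R' = pstar N q * RTilde N p := by
    apply mul_left_cancel₀ hG
    linear_combination hstar - q * hR' - pstar N q * hpR
  refine (IsAlgClosed.splits (RTilde N p)).dvd_of_roots_le_roots hR ?_
  rw [Multiset.le_iff_count]
  intro b
  rw [count_roots, count_roots, le_rootMultiplicity_iff hq0]
  by_cases hb : X - C b ∣ RTilde N p
  · by_cases hb1 : ‖b‖ = 1
    · have hmult : rootMultiplicity b (RTilde N p) ≤ 1 := by
        by_contra hlt
        exact not_sq_dvd_RTilde hp h0 hb1 ((le_rootMultiplicity_iff hR).1 (by omega))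
      refine (pow_dvd_pow _ hmult).trans ?_
      rw [pow_one, dvd_iff_isRoot]
      have hnn : ∀ z : ℂ, ‖z‖ = 1 → ∃ r : ℝ, 0 ≤ r ∧
          q.eval z * starRingEnd ℂ ((X ^ mTilde N p * RTilde N p).eval z) = r := fun z hz =>
        nonneg_of_mul_nonneg_on_circle hG (fun z hz => exists_eval_GTilde N p hz)
          (by rwa [hpR]) hz
      refine eval_eq_zero_of_simple_root hnn hb1 ?_ ?_
      · simp [(dvd_iff_isRoot.1 hb).eq_zero]
      -- With `R̃ = (X - b) T`, the derivative of `X^m̃ R̃` at `b` is `b^m̃ T(b)`, nonzero because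
      -- the zero is simple.
      · obtain ⟨T, hT⟩ := hb
        have hTb : T.eval b ≠ 0 := by
          intro hTb
          refine not_sq_dvd_RTilde hp h0 hb1 ?_
          rw [hT, pow_two]
          exact mul_dvd_mul_left _ (dvd_iff_isRoot.2 hTb)
        rw [hT]
        simpa [derivative_mul, ne_zero_of_norm_eq_one hb1] using hTb
    · have hb2 := not_common_root_of_norm_ne_one hp h0 hR' hb1 hb
      have hcop : IsCoprime (X - C b) R' :=
        ((irreducible_X_sub_C b).coprime_iff_not_dvd).2 hb2
      refine (hcop.pow_left).dvd_of_dvd_mul_right (?_ : _ ∣ q * R')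
      rw [hmul]
      exact (pow_rootMultiplicity_dvd _ b).mul_left _
  · rw [rootMultiplicity_eq_zero (by rwa [dvd_iff_isRoot] at hb), pow_zero]
    exact one_dvd _

/-- A polynomial `S` for which `z^{-m} S` is real on the circle, up to finitely many points, is
self-conjugate-reciprocal. -/
theorem coeff_symm_of_real_on_circle {S R : ℂ[X]} {m : ℕ} (hR : R ≠ 0)
    (h : ∀ z : ℂ, ‖z‖ = 1 → R.eval z ≠ 0 →
      S.eval z = z ^ (2 * m) * starRingEnd ℂ (S.eval z)) :
    (∀ i ≤ 2 * m, S.coeff i = starRingEnd ℂ (S.coeff (2 * m - i))) ∧ S.natDegree ≤ 2 * m := by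
  -- No bound on the degree of `S` is known yet, so the reflection uses a large formal degree `K`;
  -- comparing coefficients gives both the symmetry and the bound `2m`.
  set K := S.natDegree + 2 * m with hK
  have hSK : S.natDegree ≤ K := by omega
  have heq : S * X ^ K = pstar K S * X ^ (2 * m) := by
    -- Multiplying by `R` makes the identity trivial at the zeros of `R`, where `h` says nothing.
    apply mul_left_cancel₀ hR
    refine eq_of_eval_eq_on_circle fun z hz => ?_
    by_cases hRz : R.eval z = 0
    · simp [hRz]
    simp only [eval_mul, eval_pow, eval_X, eval_pstar hSK hz]
    linear_combination R.eval z * z ^ K * h z hz hRz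
  have hc : ∀ i, S.coeff i = (pstar K S).coeff (K + i - 2 * m) := by
    intro i
    have h1 := congrArg (fun f => f.coeff (i + K)) heq
    simp only [coeff_mul_X_pow] at h1
    rw [h1, show i + K = (K + i - 2 * m) + 2 * m by omega, coeff_mul_X_pow]
  constructor
  · intro i hi
    rw [hc, coeff_pstar, if_pos (by omega)]
    congr 2
    omega
  · rw [natDegree_le_iff_coeff_eq_zero]
    intro i hi
    rw [hc, coeff_pstar, if_neg (by omega)]

theorem exists_cofactor {N : ℕ} {p q : ℂ[X]} (hp : p.natDegree ≤ N) (h0 : p ≠ 0)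
    (hq : q.natDegree ≤ N)
    (h : ∀ z : ℂ, ‖z‖ = 1 → ∃ r : ℝ, 0 ≤ r ∧ q.eval z * starRingEnd ℂ (p.eval z) = r) :
    ∃ S : ℂ[X], q = S * RTilde N p ∧
      (∀ i ≤ 2 * mTilde N p, S.coeff i = starRingEnd ℂ (S.coeff (2 * mTilde N p - i))) ∧
      S.natDegree ≤ 2 * mTilde N p := by
  obtain ⟨S, hS⟩ := RTilde_dvd hp h0 hq h
  have hpR := GTilde_mul_RTilde hp h0
  have hG := GTilde_ne_zero hp h0
  have hR : RTilde N p ≠ 0 := right_ne_zero_of_mul (hpR ▸ h0)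
  refine ⟨S, by rw [hS, mul_comm], coeff_symm_of_real_on_circle hR fun z hz hRz => ?_⟩
  obtain ⟨r, -, hr⟩ := nonneg_of_mul_nonneg_on_circle hG
    (fun z hz => exists_eval_GTilde N p hz) (by rwa [hpR]) hz
  have hzz : z * starRingEnd ℂ z = 1 := by
    rw [Complex.mul_conj, Complex.normSq_eq_norm_sq, hz]; simp
  have hn : z ^ mTilde N p * starRingEnd ℂ z ^ mTilde N p = 1 := by rw [← mul_pow, hzz, one_pow]
  rw [hS] at hr
  simp only [eval_mul, eval_pow, eval_X, map_mul, map_pow] at hr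
  have hr2 := congrArg (starRingEnd ℂ) hr
  simp only [map_mul, map_pow, Complex.conj_conj, Complex.conj_ofReal] at hr2
  have hRR : (RTilde N p).eval z * starRingEnd ℂ ((RTilde N p).eval z) ≠ 0 :=
    mul_ne_zero hRz (by simpa using hRz)
  apply mul_left_cancel₀ hRR
  rw [two_mul, pow_add]
  linear_combination z ^ mTilde N p * (hr - hr2) -
    (RTilde N p).eval z * starRingEnd ℂ ((RTilde N p).eval z) * S.eval z * hn

/-! ### The matrix as a linear map on self-conjugate-reciprocal polynomials -/

/-- The real coordinates of a polynomial `S` with `s_i = conj(s_{2m-i})`. -/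
def symVec (m : ℕ) (S : ℂ[X]) : Fin (m + 1) ⊕ Fin m → ℝ :=
  -- The middle coefficient is halved because the column `l = 0` of the matrix counts `C̃(k_j - m̃)`
  -- twice.
  Sum.elim (Fin.cases ((S.coeff m).re / 2) fun i : Fin m => (S.coeff (m + (i + 1))).re)
    fun i => (S.coeff (m + (i + 1))).im

theorem sum_range_two_mul_add_one {A : Type*} [AddCommMonoid A] (f : ℕ → A) (m : ℕ) :
    ∑ i ∈ Finset.range (2 * m + 1), f i =
      f m + ∑ i : Fin m, (f (m + (i + 1)) + f (m - (i + 1))) := by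
  rw [show 2 * m + 1 = (m + 1) + m by ring, Finset.sum_range_add, Finset.sum_range_succ,
    ← Finset.sum_range_reflect, add_comm _ (f m), add_assoc, Finset.sum_add_distrib,
    Fin.sum_univ_eq_sum_range (fun i => f (m + (i + 1))),
    Fin.sum_univ_eq_sum_range (fun i => f (m - (i + 1))), add_comm (∑ i ∈ Finset.range m, _)]
  congr 2
  · refine Finset.sum_congr rfl fun i _ => ?_
    congr 1; ring
  · refine Finset.sum_congr rfl fun i _ => ?_
    congr 1; omega

theorem coeff_mul_RTilde (N : ℕ) (p : ℂ[X]) {S : ℂ[X]} {d : ℕ} (hS : S.natDegree ≤ d) (n : ℕ) :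
    (S * RTilde N p).coeff n =
      ∑ i ∈ Finset.range (d + 1), S.coeff i * CTilde N p ((n : ℤ) - i) := by
  have h1 : (S * RTilde N p).coeff n =
      ∑ i ∈ Finset.range (n + 1), S.coeff i * CTilde N p ((n : ℤ) - i) := by
    rw [coeff_mul, Finset.Nat.sum_antidiagonal_eq_sum_range_succ
      (fun i j => S.coeff i * (RTilde N p).coeff j)]
    refine Finset.sum_congr rfl fun i hi => ?_
    have hi : i ≤ n := by simpa [Nat.lt_succ_iff] using hi
    rw [CTilde, if_pos (by omega)]
    congr 2
    omega
  -- Both sums extend to a common range: beyond `n` the index of `CTilde` is negative, beyond `d`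
  -- the coefficient of `S` vanishes.
  have h2 : ∀ K, n ≤ K → d ≤ K → (∑ i ∈ Finset.range (n + 1), S.coeff i * CTilde N p ((n : ℤ) - i) =
      ∑ i ∈ Finset.range (K + 1), S.coeff i * CTilde N p ((n : ℤ) - i)) ∧
      (∑ i ∈ Finset.range (d + 1), S.coeff i * CTilde N p ((n : ℤ) - i) =
      ∑ i ∈ Finset.range (K + 1), S.coeff i * CTilde N p ((n : ℤ) - i)) := by
    intro K hn hd
    constructor
    · refine Finset.sum_subset (Finset.range_subset_range.2 (by omega)) fun i _ hi => ?_
      rw [Finset.mem_range, not_lt] at hi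
      rw [CTilde, if_neg (by omega), mul_zero]
    · refine Finset.sum_subset (Finset.range_subset_range.2 (by omega)) fun i _ hi => ?_
      rw [Finset.mem_range, not_lt] at hi
      rw [coeff_eq_zero_of_natDegree_lt (by omega), zero_mul]
  obtain ⟨h3, h4⟩ := h2 (max n d) (le_max_left _ _) (le_max_right _ _)
  rw [h1, h3, h4]

theorem coeff_mul_RTilde_of_symm (N : ℕ) (p : ℂ[X]) {S : ℂ[X]} {m : ℕ}
    (hS : S.natDegree ≤ 2 * m)
    (hsym : ∀ i ≤ 2 * m, S.coeff i = starRingEnd ℂ (S.coeff (2 * m - i))) (n : ℕ) :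
    (S * RTilde N p).coeff n = ((S.coeff m).re : ℂ) * CTilde N p ((n : ℤ) - m) +
      ∑ i : Fin m, (S.coeff (m + (i + 1)) * CTilde N p ((n : ℤ) - ((i : ℕ) + 1) - m) +
        starRingEnd ℂ (S.coeff (m + (i + 1))) * CTilde N p ((n : ℤ) + ((i : ℕ) + 1) - m)) := by
  rw [coeff_mul_RTilde N p hS, sum_range_two_mul_add_one]
  have hm : ((S.coeff m).re : ℂ) = S.coeff m := by
    have := hsym m (by omega)
    rw [show 2 * m - m = m by omega] at this
    exact Complex.conj_eq_iff_re.1 this.symm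
  rw [hm]
  congr 1
  refine Finset.sum_congr rfl fun i _ => ?_
  have hi := i.2
  rw [hsym (m - (i + 1)) (by omega), show 2 * m - (m - (i + 1)) = m + (i + 1) by omega]
  congr 3
  · push_cast; ring
  · push_cast [Nat.cast_sub (show (i : ℕ) + 1 ≤ m by omega)]; ring

/-- With `s_{m̃+l} = x + iy`, the terms `±l` of the convolution pair up to `s C̃(k_j-l-m̃) + conj(s)
C̃(k_j+l-m̃)`, of real part `x Ã⁺ + y B̃⁻` and imaginary part `x B̃⁺ - y Ã⁻`. -/
theorem MTilde_mulVec_symVec (N : ℕ) {M : ℕ} (k : Fin M → ℕ) (p : ℂ[X]) {S : ℂ[X]}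
    (hS : S.natDegree ≤ 2 * mTilde N p)
    (hsym : ∀ i ≤ 2 * mTilde N p, S.coeff i = starRingEnd ℂ (S.coeff (2 * mTilde N p - i))) :
    (MTilde N k p).mulVec (symVec (mTilde N p) S) =
      Sum.elim (fun j => ((S * RTilde N p).coeff (k j)).re)
        fun j => ((S * RTilde N p).coeff (k j)).im := by
  rw [MTilde, Matrix.fromBlocks_mulVec]
  congr 1
  · funext j
    rw [coeff_mul_RTilde_of_symm N p hS hsym]
    simp only [Pi.add_apply, Matrix.mulVec, dotProduct, symVec, Sum.elim_comp_inl,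
      Sum.elim_comp_inr, APlus, BMinus, Matrix.of_apply, Fin.sum_univ_succ, Fin.cases_zero,
      Fin.cases_succ, ATilde, BTilde, Complex.add_re, Complex.re_sum, Complex.mul_re,
      Complex.ofReal_re, Complex.ofReal_im, Complex.conj_re, Complex.conj_im, Fin.val_zero,
      Fin.val_succ, Nat.cast_zero, add_zero, sub_zero, add_assoc, ← Finset.sum_add_distrib]
    push_cast
    congr 1
    · ring
    · refine Finset.sum_congr rfl fun i _ => ?_
      ring
  · funext j
    rw [coeff_mul_RTilde_of_symm N p hS hsym]
    simp only [Pi.add_apply, Matrix.mulVec, dotProduct, symVec, Sum.elim_comp_inl,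
      Sum.elim_comp_inr, BPlus, AMinus, Matrix.of_apply, Matrix.neg_apply, Fin.sum_univ_succ,
      Fin.cases_zero, Fin.cases_succ, ATilde, BTilde, Complex.add_im, Complex.im_sum,
      Complex.mul_im, Complex.ofReal_re, Complex.ofReal_im, Complex.conj_re, Complex.conj_im,
      Fin.val_zero, Fin.val_succ, Nat.cast_zero, zero_mul, add_zero, sub_zero, add_assoc,
      ← Finset.sum_add_distrib]
    push_cast
    congr 1
    · ring
    · refine Finset.sum_congr rfl fun i _ => ?_
      ring

/-- By symmetry the middle coefficient is real and the upper half determines the lower one, so the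
coordinates lose nothing. The case `c = 0` is injectivity at `0`. -/
theorem eq_smul_of_symVec_eq {m : ℕ} {S T : ℂ[X]} (hS : S.natDegree ≤ 2 * m)
    (hsymS : ∀ i ≤ 2 * m, S.coeff i = starRingEnd ℂ (S.coeff (2 * m - i)))
    (hT : T.natDegree ≤ 2 * m)
    (hsymT : ∀ i ≤ 2 * m, T.coeff i = starRingEnd ℂ (T.coeff (2 * m - i))) {c : ℝ}
    (h : symVec m S = c • symVec m T) : S = (c : ℂ) • T := by
  have him : ∀ {U : ℂ[X]}, (∀ i ≤ 2 * m, U.coeff i = starRingEnd ℂ (U.coeff (2 * m - i))) →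
      (U.coeff m).im = 0 := by
    intro U hU
    have := hU m (by omega)
    rw [show 2 * m - m = m by omega] at this
    exact Complex.conj_eq_iff_im.1 this.symm
  have hge : ∀ l ≤ m, S.coeff (m + l) = c * T.coeff (m + l) := by
    rintro (_ | l) hl
    · have h1 := congrFun h (Sum.inl 0)
      simp only [symVec, Sum.elim_inl, Fin.cases_zero, Pi.smul_apply, smul_eq_mul] at h1
      refine Complex.ext ?_ ?_
      · simp only [add_zero, Complex.re_ofReal_mul]
        linarith
      · simp [him hsymS, him hsymT]
    · have h1 := congrFun h (Sum.inl (Fin.succ ⟨l, hl⟩))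
      have h2 := congrFun h (Sum.inr ⟨l, hl⟩)
      simp only [symVec, Sum.elim_inl, Sum.elim_inr, Fin.cases_succ, Pi.smul_apply,
        smul_eq_mul] at h1 h2
      refine Complex.ext ?_ ?_
      · simpa using h1
      · simpa using h2
  ext i
  rw [coeff_smul, smul_eq_mul]
  rcases le_or_gt i (2 * m) with hi | hi
  · rcases le_or_gt m i with hmi | hmi
    · have := hge (i - m) (by omega)
      rwa [show m + (i - m) = i by omega] at this
    · have := hge (m - i) (by omega)
      rw [hsymS i hi, hsymT i hi, show 2 * m - i = m + (m - i) by omega, this, map_mul,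
        Complex.conj_ofReal]
  · rw [coeff_eq_zero_of_natDegree_lt (by omega), coeff_eq_zero_of_natDegree_lt (by omega),
      mul_zero]

theorem symVec_ne_zero {m : ℕ} {S : ℂ[X]} (hS : S.natDegree ≤ 2 * m)
    (hsym : ∀ i ≤ 2 * m, S.coeff i = starRingEnd ℂ (S.coeff (2 * m - i))) (h0 : S ≠ 0) :
    symVec m S ≠ 0 := by
  intro h
  apply h0
  simpa using eq_smul_of_symVec_eq hS hsym hS hsym (c := 0) (by simpa using h)

theorem exists_smul_eq_of_rank {m n : Type*} [Fintype m] [Fintype n] [DecidableEq n] {K : Type*}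
    [Field K] (A : Matrix m n K) (hA : A.rank + 1 = Fintype.card n) {v w : n → K} (hv0 : v ≠ 0)
    (hv : A.mulVec v = 0) (hw : A.mulVec w = 0) : ∃ c : K, w = c • v := by
  have h1 := LinearMap.finrank_range_add_finrank_ker A.mulVecLin
  rw [Module.finrank_fintype_fun_eq_card, ← hA] at h1
  have h2 : Module.finrank K (LinearMap.ker A.mulVecLin) = 1 := by
    have : A.rank = Module.finrank K (LinearMap.range A.mulVecLin) := rfl
    omega
  have hv' : (⟨v, by simpa using hv⟩ : LinearMap.ker A.mulVecLin) ≠ 0 := by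
    simpa [Subtype.ext_iff] using hv0
  obtain ⟨c, hc⟩ := (finrank_eq_one_iff_of_nonzero' _ hv').1 h2 ⟨w, by simpa using hw⟩
  exact ⟨c, (congrArg Subtype.val hc).symm⟩

/-- Under the rank condition, an admissible polynomial with the same argument as `p` on the circle
is a real multiple of `p`. -/
theorem eq_smul_of_rank {N M : ℕ} {k : Fin M → ℕ} {p q : ℂ[X]} (h0 : p ≠ 0)
    (hp : p ∈ lacunary (admissible N k)) (hq : q ∈ lacunary (admissible N k))
    (hrank : (MTilde N k p).rank = 2 * mTilde N p)
    (h : ∀ z : ℂ, ‖z‖ = 1 → ∃ r : ℝ, 0 ≤ r ∧ q.eval z * starRingEnd ℂ (p.eval z) = r) :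
    ∃ c : ℝ, q = (c : ℂ) • p := by
  have hpd := natDegree_le_of_mem_lacunary hp
  have hqd := natDegree_le_of_mem_lacunary hq
  -- Applied to `p` itself, this yields the nonzero kernel vector.
  obtain ⟨T, hTp, hTsym, hTd⟩ := exists_cofactor hpd h0 hpd fun z _ =>
    ⟨Complex.normSq (p.eval z), Complex.normSq_nonneg _, Complex.mul_conj _⟩
  obtain ⟨S, hSq, hSsym, hSd⟩ := exists_cofactor hpd h0 hqd h
  have hT0 : T ≠ 0 := left_ne_zero_of_mul (hTp ▸ h0)
  have hTker := MTilde_mulVec_symVec N k p hTd hTsym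
  have hSker := MTilde_mulVec_symVec N k p hSd hSsym
  rw [← hTp] at hTker
  rw [← hSq] at hSker
  simp only [coeff_eq_zero_of_mem_lacunary hp, coeff_eq_zero_of_mem_lacunary hq,
    Complex.zero_re, Complex.zero_im] at hTker hSker
  have hz : (Sum.elim (fun _ => 0) (fun _ => 0) : Fin M ⊕ Fin M → ℝ) = 0 := by
    funext x; rcases x with x | x <;> rfl
  rw [hz] at hTker hSker
  obtain ⟨c, hc⟩ := exists_smul_eq_of_rank (MTilde N k p)
    (by rw [hrank]; simp; ring) (symVec_ne_zero hTd hTsym hT0) hTker hSker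
  refine ⟨c, ?_⟩
  rw [hSq, eq_smul_of_symVec_eq hSd hSsym hTd hTsym hc, smul_mul_assoc, ← hTp]

/-! ### The functional of integration against a bounded function -/

section Functional

variable {α : Type*} [MeasurableSpace α] {μ : Measure α} {u : α → ℂ}

theorem integrable_mul_L1 (hu : AEStronglyMeasurable u μ) (hu1 : ∀ x, ‖u x‖ ≤ 1)
    (f : Lp ℂ 1 μ) : Integrable (fun x => u x * f x) μ :=
  (L1.integrable_coeFn f).bdd_mul hu (Filter.Eventually.of_forall hu1)

/-- The functional `f ↦ ∫ u f` on `L¹`, for `|u| ≤ 1`. -/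
def integralFunctional (hu : AEStronglyMeasurable u μ) (hu1 : ∀ x, ‖u x‖ ≤ 1) :
    Lp ℂ 1 μ →L[ℂ] ℂ :=
  LinearMap.mkContinuous
    { toFun := fun f => ∫ x, u x * f x ∂μ
      map_add' := fun f g => by
        rw [← integral_add (integrable_mul_L1 hu hu1 f) (integrable_mul_L1 hu hu1 g)]
        refine integral_congr_ae ?_
        filter_upwards [Lp.coeFn_add f g] with x hx
        rw [hx, Pi.add_apply, mul_add]
      map_smul' := fun c f => by
        rw [RingHom.id_apply, smul_eq_mul, ← integral_const_mul]
        refine integral_congr_ae ?_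
        filter_upwards [Lp.coeFn_smul c f] with x hx
        rw [hx, Pi.smul_apply, smul_eq_mul, mul_left_comm] }
    1 (fun f => by
      rw [one_mul, L1.norm_eq_integral_norm]
      refine norm_integral_le_of_norm_le (L1.integrable_coeFn f).norm
        (Filter.Eventually.of_forall fun x => ?_)
      rw [norm_mul]
      exact mul_le_of_le_one_left (norm_nonneg _) (hu1 x))

theorem integralFunctional_apply (hu : AEStronglyMeasurable u μ) (hu1 : ∀ x, ‖u x‖ ≤ 1)
    (f : Lp ℂ 1 μ) : integralFunctional hu hu1 f = ∫ x, u x * f x ∂μ := rfl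

theorem norm_integralFunctional_le (hu : AEStronglyMeasurable u μ) (hu1 : ∀ x, ‖u x‖ ≤ 1) :
    ‖integralFunctional hu hu1‖ ≤ 1 :=
  LinearMap.mkContinuous_norm_le _ zero_le_one _

/-- The equality case: a point of the unit ball where the functional is `1` has the argument of
`conj u`. -/
theorem ae_mul_eq_norm_of_integralFunctional_eq_one (hu : AEStronglyMeasurable u μ)
    (hu1 : ∀ x, ‖u x‖ ≤ 1) {f : Lp ℂ 1 μ} (hf : ‖f‖ ≤ 1) (h : integralFunctional hu hu1 f = 1) :
    ∀ᵐ x ∂μ, u x * f x = ‖f x‖ := by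
  have hi := integrable_mul_L1 hu hu1 f
  have hn := (L1.integrable_coeFn f).norm
  have hle : ∀ x, ‖u x * f x‖ ≤ ‖f x‖ := fun x => by
    rw [norm_mul]; exact mul_le_of_le_one_left (norm_nonneg _) (hu1 x)
  have hre : ∫ x, (u x * f x).re ∂μ = 1 := by
    have h1 : ∫ x, RCLike.re (u x * f x) ∂μ = RCLike.re (∫ x, u x * f x ∂μ) := integral_re hi
    rw [integralFunctional_apply] at h
    rw [h] at h1
    simpa using h1
  have hpos : ∀ x, 0 ≤ ‖f x‖ - (u x * f x).re := fun x =>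
    sub_nonneg.2 ((Complex.re_le_norm _).trans (hle x))
  have hint : Integrable (fun x => ‖f x‖ - (u x * f x).re) μ := hn.sub hi.re
  -- The integral equals `‖f‖ - 1 ≤ 0`, while the integrand is nonnegative.
  have hzero : ∫ x, (‖f x‖ - (u x * f x).re) ∂μ = 0 := by
    refine le_antisymm ?_ (integral_nonneg hpos)
    have h2 : ∫ x, (‖f x‖ - (u x * f x).re) ∂μ = ∫ x, ‖f x‖ ∂μ - ∫ x, (u x * f x).re ∂μ :=
      integral_sub hn hi.re
    rw [h2, hre, ← L1.norm_eq_integral_norm]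
    linarith
  rw [integral_eq_zero_iff_of_nonneg hpos hint] at hzero
  filter_upwards [hzero] with x hx
  have h3 : (u x * f x).re = ‖f x‖ := by
    have : ‖f x‖ - (u x * f x).re = 0 := hx
    linarith
  have h4 : ‖u x * f x‖ = (u x * f x).re :=
    le_antisymm ((hle x).trans h3.ge) (Complex.re_le_norm _)
  have h5 := Complex.re_eq_norm.1 h4.symm
  rw [← h3]
  exact Complex.ext (Complex.ofReal_re _).symm
    ((Complex.nonneg_iff.1 h5).2.symm.trans (Complex.ofReal_im _).symm)

end Functional

/-! ### The sign functional of a polynomial -/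

theorem coeFn_toL1 (p : ℂ[X]) :
    (toL1 p : AddCircle (2 * Real.pi) → ℂ) =ᵐ[AddCircle.haarAddCircle] onCircle p :=
  ContinuousMap.coeFn_toLp _ _

/-- The conjugate of the sign of a polynomial on the circle. -/
def conjSign (p : ℂ[X]) (t : AddCircle (2 * Real.pi)) : ℂ :=
  starRingEnd ℂ (onCircle p t) / ‖onCircle p t‖

theorem aestronglyMeasurable_conjSign (p : ℂ[X]) :
    AEStronglyMeasurable (conjSign p) AddCircle.haarAddCircle := by
  have h1 : Continuous fun t => starRingEnd ℂ (onCircle p t) :=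
    Complex.continuous_conj.comp (onCircle p).continuous
  have h2 : Continuous fun t => (‖onCircle p t‖ : ℂ) :=
    Complex.continuous_ofReal.comp (onCircle p).continuous.norm
  exact (h1.measurable.div h2.measurable).aestronglyMeasurable

/-- Only an inequality: at the zeros of `p` the quotient is `0` by the convention `x / 0 = 0`. -/
theorem norm_conjSign_le (p : ℂ[X]) (t : AddCircle (2 * Real.pi)) : ‖conjSign p t‖ ≤ 1 := by
  rw [conjSign, norm_div, Complex.norm_conj, Complex.norm_real, norm_norm]
  exact div_self_le_one _

theorem conjSign_mul_norm (p : ℂ[X]) (t : AddCircle (2 * Real.pi)) :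
    conjSign p t * ‖onCircle p t‖ = starRingEnd ℂ (onCircle p t) := by
  by_cases h : onCircle p t = 0
  · simp [h]
  · exact div_mul_cancel₀ _ (by simpa using h)

theorem conjSign_mul_self (p : ℂ[X]) (t : AddCircle (2 * Real.pi)) :
    conjSign p t * onCircle p t = ‖onCircle p t‖ := by
  by_cases h : onCircle p t = 0
  · simp [h]
  · have h' : (‖onCircle p t‖ : ℂ) ≠ 0 := by simpa using h
    rw [conjSign, div_mul_eq_mul_div, div_eq_iff h', mul_comm, Complex.mul_conj,
      Complex.normSq_eq_norm_sq]
    push_cast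
    ring

/-- The functional `f ↦ ∫ f conj(p) / |p|` on `L¹`. -/
def signFunctional (p : ℂ[X]) : L1 →L[ℂ] ℂ :=
  integralFunctional (aestronglyMeasurable_conjSign p) (norm_conjSign_le p)

theorem signFunctional_self (p : ℂ[X]) : signFunctional p (toL1 p) = ‖toL1 p‖ := by
  rw [signFunctional, integralFunctional_apply, L1.norm_eq_integral_norm, ← integral_complex_ofReal]
  refine integral_congr_ae ?_
  filter_upwards [coeFn_toL1 p] with t ht
  rw [ht, conjSign_mul_self]

theorem mul_conj_nonneg_of_signFunctional_eq_one {p q : ℂ[X]} (hq : ‖toL1 q‖ ≤ 1)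
    (h : signFunctional p (toL1 q) = 1) {z : ℂ} (hz : ‖z‖ = 1) :
    ∃ r : ℝ, 0 ≤ r ∧ q.eval z * starRingEnd ℂ (p.eval z) = r := by
  have hae := ae_mul_eq_norm_of_integralFunctional_eq_one _ _ hq h
  have hae2 : (fun t => onCircle q t * starRingEnd ℂ (onCircle p t)) =ᵐ[AddCircle.haarAddCircle]
      fun t => ((‖onCircle q t‖ * ‖onCircle p t‖ : ℝ) : ℂ) := by
    filter_upwards [hae, coeFn_toL1 q] with t ht1 ht2
    rw [ht2] at ht1
    rw [← conjSign_mul_norm, Complex.ofReal_mul, ← ht1]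
    ring
  have hc1 : Continuous fun t => onCircle q t * starRingEnd ℂ (onCircle p t) :=
    (onCircle q).continuous.mul (Complex.continuous_conj.comp (onCircle p).continuous)
  have hc2 : Continuous fun t => ((‖onCircle q t‖ * ‖onCircle p t‖ : ℝ) : ℂ) :=
    Complex.continuous_ofReal.comp
      ((onCircle q).continuous.norm.mul (onCircle p).continuous.norm)
  -- Both sides are continuous and Haar measure charges every nonempty open set, so equality holds
  -- at every point.
  have heq := (Continuous.ae_eq_iff_eq _ hc1 hc2).1 hae2
  obtain ⟨t, rfl⟩ := exists_exp_of_norm_eq_one hz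
  have hval : ∀ f : ℂ[X], onCircle f (t : AddCircle (2 * Real.pi)) =
      f.eval (Complex.exp (t * Complex.I)) := by
    intro f
    show f.eval ((AddCircle.toCircle (t : AddCircle (2 * Real.pi)) : Circle) : ℂ) = _
    rw [AddCircle.toCircle_apply_mk, div_self Real.two_pi_pos.ne', one_mul, Circle.coe_exp]
  have := congrFun heq (t : AddCircle (2 * Real.pi))
  simp only [hval] at this
  exact ⟨_, mul_nonneg (norm_nonneg _) (norm_nonneg _), this⟩

end Fewnomial

end

/-! ### Assembling the exposed point -/

theorem corollary3p2 (N M : ℕ) (hN : 0 < N) (k : Fin M → ℕ) (hk : StrictMono k)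
    (hk_pos : ∀ j, 0 < k j) (hk_lt : ∀ j, k j < N)
    (p : Polynomial ℂ) (hp : p ∈ Fewnomial.lacunary (Fewnomial.admissible N k))
    (hnorm : ‖Fewnomial.toL1 p‖ = 1)
    (hrank : (Fewnomial.MTilde N k p).rank = 2 * Fewnomial.mTilde N p) :
    Fewnomial.IsExposedPointOfBall
      (⟨Fewnomial.toL1 p, Submodule.mem_map_of_mem hp⟩ :
        Fewnomial.lacunaryL1 (Fewnomial.admissible N k)) := by
  have h0 : p ≠ 0 := by
    rintro rfl
    simp at hnorm
  set ξ : Fewnomial.lacunaryL1 (Fewnomial.admissible N k) :=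
    ⟨Fewnomial.toL1 p, Submodule.mem_map_of_mem hp⟩ with hξ
  have hξ1 : ‖ξ‖ = 1 := hnorm
  set φ : Fewnomial.lacunaryL1 (Fewnomial.admissible N k) →L[ℂ] ℂ :=
    (Fewnomial.signFunctional p).comp (Submodule.subtypeL _) with hφ
  have hφξ : φ ξ = 1 := by
    have := Fewnomial.signFunctional_self p
    rwa [hnorm, Complex.ofReal_one] at this
  have hle : ‖φ‖ ≤ 1 := by
    refine φ.opNorm_le_bound zero_le_one fun x => ?_
    exact (Fewnomial.signFunctional p).le_of_opNorm_le
      (Fewnomial.norm_integralFunctional_le _ _) (x : Fewnomial.L1)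
  refine ⟨by simp [hξ1], φ, le_antisymm hle ?_, ?_⟩
  · have := φ.le_opNorm ξ
    rwa [hφξ, hξ1, norm_one, mul_one] at this
  · ext x
    simp only [mem_closedBall_zero_iff, Set.mem_singleton_iff]
    constructor
    · rintro ⟨hx1, hφx⟩
      obtain ⟨x, q, hq, rfl⟩ := x
      obtain ⟨c, rfl⟩ := Fewnomial.eq_smul_of_rank h0 hp hq hrank fun z hz =>
        Fewnomial.mul_conj_nonneg_of_signFunctional_eq_one (p := p) hx1 hφx hz
      have hx : (⟨Fewnomial.toL1 ((c : ℂ) • p), ⟨(c : ℂ) • p, hq, rfl⟩⟩ :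
          Fewnomial.lacunaryL1 (Fewnomial.admissible N k)) = (c : ℂ) • ξ :=
        Subtype.ext (map_smul Fewnomial.toL1 (c : ℂ) p)
      -- The functional takes the value `c` at `c ξ`, so `c = 1`.
      rw [hx, map_smul, hφξ, smul_eq_mul, mul_one] at hφx
      rw [hx, hφx, one_smul]
    · rintro rfl
      exact ⟨hξ1.le, hφξ⟩
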